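/- All graphs are finite, simple and undirected. Let $K_3 \cup K_1$ be the disjoint union of a triangle and an isolated vertex. A graph $H$ is an induced minor of a graph $G$ if a graph isomorphic to $H$ can be obtained from $G$ by repeated vertex deletion and edge contraction. The clique-width $\operatorname{cw}(G)$ of a graph $G$ with at least one vertex is the minimum number of labels needed to construct $G$ (up to isomorphism) by means of the following four operations: (i) creation of a new vertex with label $i$; (ii) disjoint union of two labelled graphs; (iii) joining by an edge every vertex labelled $i$ to every vertex labelled $j$, where $i \neq j$; (iv) renaming label $i$ to label $j$. (The graph without vertices has clique-width $0$.) Theorem. The class of graphs that do not contain $K_3 \cup K_1$ as an induced minor does not have bounded clique-width: there is no constant $c$ such that $\operatorname{cw}(G) \le c$ for every graph $G$ that does not contain $K_3 \cup K_1$ as an induced minor. -/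

import Mathlib

namespace SimpleGraph

universe u

/-- Contraction of the edge `uv` of `G`: the vertex `v` is removed, and `u`, which now stands for
the merged vertex, becomes adjacent to every other vertex that was adjacent to `u` or to `v`. -/
def contractEdge {V : Type u} (G : SimpleGraph V) (u v : V) : SimpleGraph {x : V // x ≠ v} where
  Adj x y := x ≠ y ∧
    (G.Adj x y ∨ ((x : V) = u ∧ G.Adj v y) ∨ ((y : V) = u ∧ G.Adj v x))
  symm.symm := by
    rintro x y ⟨hne, h | h | h⟩
    · exact ⟨hne.symm, Or.inl h.symm⟩
    · exact ⟨hne.symm, Or.inr (Or.inr h)⟩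
    · exact ⟨hne.symm, Or.inr (Or.inl h)⟩
  loopless.irrefl := fun _ h => h.1 rfl

/-- `IsInducedMinor H G`: a graph isomorphic to `H` can be obtained from `G` by repeated vertex
deletion and edge contraction. -/
inductive IsInducedMinor {W : Type*} (H : SimpleGraph W) :
    ∀ {V : Type u}, SimpleGraph V → Prop
  | ofIso {V : Type u} {G : SimpleGraph V} (e : H ≃g G) : IsInducedMinor H G
  | deleteVertex {V : Type u} {G : SimpleGraph V} (v : V)
      (h : IsInducedMinor H (G.induce {x : V | x ≠ v})) : IsInducedMinor H G
  | contractEdge {V : Type u} {G : SimpleGraph V} (u v : V) (huv : G.Adj u v)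
      (h : IsInducedMinor H (G.contractEdge u v)) : IsInducedMinor H G

/-- `G` is `H`-induced-minor-free. -/
def InducedMinorFree {W : Type*} (H : SimpleGraph W) {V : Type u} (G : SimpleGraph V) : Prop :=
  ¬ IsInducedMinor H G

/-- The graph `K₃ ∪ K₁`: the disjoint union of a triangle and an isolated vertex. -/
def K3UnionK1 : SimpleGraph (Fin 3 ⊕ Fin 1) :=
  completeGraph (Fin 3) ⊕g completeGraph (Fin 1)

/-- Expressions that describe the construction of a labelled graph with labels from `Fin k`, by the
four operations of clique-width. -/
inductive CliqueExpr (k : ℕ) : Type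
  /-- Creation of a new vertex with label `i`. -/
  | vertex (i : Fin k) : CliqueExpr k
  /-- Disjoint union of two labelled graphs. -/
  | union (a b : CliqueExpr k) : CliqueExpr k
  /-- Joining every vertex labelled `i` to every vertex labelled `j` by an edge, where `i ≠ j`. -/
  | join (i j : Fin k) (hij : i ≠ j) (a : CliqueExpr k) : CliqueExpr k
  /-- Renaming label `i` to label `j`. -/
  | relabel (i j : Fin k) (a : CliqueExpr k) : CliqueExpr k

namespace CliqueExpr

/-- The vertex set of the graph that an expression constructs. -/
def Vert {k : ℕ} : CliqueExpr k → Type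
  | vertex _ => Unit
  | union a b => a.Vert ⊕ b.Vert
  | join _ _ _ a => a.Vert
  | relabel _ _ a => a.Vert

/-- The labels of the vertices of the graph that an expression constructs. -/
def label {k : ℕ} : (e : CliqueExpr k) → e.Vert → Fin k
  | vertex i => fun _ => i
  | union a b => Sum.elim a.label b.label
  | join _ _ _ a => a.label
  | relabel i j a => fun x => if a.label x = i then j else a.label x

/-- The graph that an expression constructs. -/
def graph {k : ℕ} : (e : CliqueExpr k) → SimpleGraph e.Vert
  | vertex _ => (⊥ : SimpleGraph Unit)
  | union a b => a.graph ⊕g b.graph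
  | join i j _ a => a.graph ⊔ SimpleGraph.fromRel (fun x y => a.label x = i ∧ a.label y = j)
  | relabel _ _ a => a.graph

end CliqueExpr

/-- The clique-width of a finite graph `G`: the minimum number of labels needed to construct `G`,
up to isomorphism, by the four operations. By convention the graph without vertices has
clique-width `0`. For every other finite graph the minimum is attained, see
`exists_cliqueExpr_cliqueWidth`. -/
noncomputable def cliqueWidth {V : Type*} (G : SimpleGraph V) : ℕ :=
  sInf {k : ℕ | ∃ e : CliqueExpr k, Nonempty (e.graph ≃g G)}

theorem exists_cliqueExpr_bot (n m : ℕ) (h : m + 1 ≤ n) :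
    ∃ (e : CliqueExpr n) (f : e.graph ≃g (⊥ : SimpleGraph (Fin (m + 1)))),
      ∀ x, (e.label x : ℕ) = f x := by
  induction m with
  | zero =>
    exact ⟨.vertex ⟨0, h⟩, ⟨Equiv.ofUnique Unit (Fin 1), by
      intro a b; exact Iff.rfl⟩, fun x => by
        simp [CliqueExpr.label]⟩
  | succ m ih =>
    obtain ⟨e, f, hf⟩ := ih (by omega)
    refine ⟨.union e (.vertex ⟨m + 1, h⟩),
      ⟨(Equiv.sumCongr f.toEquiv (Equiv.ofUnique Unit (Fin 1))).trans finSumFinEquiv, ?_⟩, ?_⟩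
    · intro (a : e.Vert ⊕ Unit) (b : e.Vert ⊕ Unit)
      change False ↔ (e.graph ⊕g (⊥ : SimpleGraph Unit)).Adj a b
      rcases a with a | a <;> rcases b with b | b
      · have h1 : False ↔ e.graph.Adj a b := f.map_rel_iff (a := a) (b := b)
        rw [sum_adj_inl, ← h1]
      · simp
      · simp
      · rw [sum_adj_inr, bot_adj]
    · intro (a : e.Vert ⊕ Unit)
      rcases a with a | a
      · exact hf a
      · rfl

theorem exists_cliqueExpr_fin (n : ℕ) (hn : 1 ≤ n) (G : SimpleGraph (Fin n)) :
    ∃ e : CliqueExpr n, Nonempty (e.graph ≃g G) := by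
  classical
  suffices H : ∀ s : Finset (Fin n × Fin n), ∃ (e : CliqueExpr n)
      (f : e.graph ≃g SimpleGraph.fromRel (fun x y => (x, y) ∈ s)), ∀ x, e.label x = f x by
    obtain ⟨e, f, -⟩ := H (Finset.univ.filter fun p => G.Adj p.1 p.2)
    have hG : SimpleGraph.fromRel
        (fun x y => (x, y) ∈ Finset.univ.filter fun p : Fin n × Fin n => G.Adj p.1 p.2) = G := by
      ext x y
      simp only [fromRel_adj, Finset.mem_filter, Finset.mem_univ, true_and, G.adj_comm y x, or_self]
      exact ⟨fun h => h.2, fun h => ⟨h.ne, h⟩⟩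
    rw [hG] at f
    exact ⟨e, ⟨f⟩⟩
  intro s
  induction s using Finset.induction_on with
  | empty =>
    obtain ⟨m, rfl⟩ : ∃ m, n = m + 1 := ⟨n - 1, by omega⟩
    obtain ⟨e, f, hf⟩ := exists_cliqueExpr_bot (m + 1) m le_rfl
    refine ⟨e, ⟨f.toEquiv, ?_⟩, fun x => Fin.ext (hf x)⟩
    intro a b
    simpa using (f.map_rel_iff (a := a) (b := b))
  | insert p s _ ih =>
    obtain ⟨e, f, hf⟩ := ih
    obtain ⟨i, j⟩ := p
    by_cases hij : i = j
    · subst hij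
      refine ⟨e, ⟨f.toEquiv, ?_⟩, hf⟩
      intro a b
      rw [← f.map_rel_iff (a := a) (b := b)]
      simp only [fromRel_adj, Finset.mem_insert, Prod.mk.injEq, RelIso.coe_fn_toEquiv]
      grind
    · refine ⟨.join i j hij e, ⟨f.toEquiv, ?_⟩, hf⟩
      intro (a : e.Vert) (b : e.Vert)
      have h1 := f.map_rel_iff (a := a) (b := b)
      have h2 : f a = f b ↔ a = b := f.injective.eq_iff
      change (SimpleGraph.fromRel (fun x y => (x, y) ∈ insert (i, j) s)).Adj (f a) (f b) ↔
        (e.graph ⊔ SimpleGraph.fromRel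
        (fun x y => e.label x = i ∧ e.label y = j)).Adj a b
      rw [sup_adj, ← h1]
      simp only [fromRel_adj, Finset.mem_insert, Prod.mk.injEq, hf]
      grind

/-- Every finite graph with at least one vertex is constructed by an expression with
`cliqueWidth G` labels. -/
theorem exists_cliqueExpr_cliqueWidth {V : Type*} [Finite V] [Nonempty V] (G : SimpleGraph V) :
    ∃ e : CliqueExpr (cliqueWidth G), Nonempty (e.graph ≃g G) := by
  have hne : {k : ℕ | ∃ e : CliqueExpr k, Nonempty (e.graph ≃g G)}.Nonempty := by
    let φ := Finite.equivFin V
    obtain ⟨e, ⟨f⟩⟩ := exists_cliqueExpr_fin (Nat.card V) Nat.card_pos (G.map φ.toEmbedding)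
    exact ⟨Nat.card V, e, ⟨f.trans (SimpleGraph.Iso.map φ G).symm⟩⟩
  exact Nat.sInf_mem hne

end SimpleGraph

/-!
The graphs that witness unboundedness are the complements `coDartGraph n` of the following graphs.
Replace every vertex `i` of the complete graph on `n` vertices by a clique, the `i`-th row of
`Fin n × Fin n`, so that `(i, j)` stands for the end at `i` of the edge `ij`, and join `(i, j)` to
`(j, i)`.

*No induced minor `K₃ ∪ K₁`.* The vertices that are neither equal nor adjacent to `(i, j)` in
`coDartGraph n` lie in row `i`, which is independent, except for the one vertex `(j, i)`. So they
induce a star, and of three disjoint sets of them two avoid `(j, i)` and have no edge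
between them. An induced minor `K₃ ∪ K₁` would however provide a vertex and three disjoint sets of
non-neighbours that are pairwise joined by edges (`IsInducedMinor.hasAvoidedTriangle`); these sets
need not be connected for the argument, which makes the property easy to pull back along deletions
and contractions.

*Unbounded clique-width.* A graph built with `k` labels has, for every `m ≥ 1` less than its order,
a vertex set `S` with `m < |S| ≤ 2m` whose vertices fall into `k` classes, those in a common class
having the same neighbours outside `S` (`CliqueExpr.exists_balanced_cut`): take the vertex set of
a suitable subexpression, classified by the labels at that point. In `coDartGraph (3 * t)` let `S`
be such a set with `m = 3 * t ^ 2`. A row that meets both `S` and its complement contributes a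
vertex of `S`, and at most two rows can contribute to the same class, so there are at most `2k` such
rows. At most `2t` rows lie in `S` and at most `2t` rows avoid `S`, so for large `t` there are a row
`i` in `S` and more than `k` rows `j` that avoid `S`. The vertices `(i, j)` for these `j` are told
apart by the vertices `(j, i)` outside `S`, hence lie in different classes, a contradiction.
-/

namespace SimpleGraph

universe u

/-! ### Excluding `K₃ ∪ K₁` as an induced minor -/

/-- A vertex `w` together with three disjoint vertex sets, the fibres of `f` over `some i`, that
consist of vertices neither equal nor adjacent to `w` and are pairwise joined by an edge. The three
sets are not required to be connected. -/
def HasAvoidedTriangle {V : Type u} (G : SimpleGraph V) : Prop :=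
  ∃ (w : V) (f : V → Option (Fin 3)), (∀ x, f x ≠ none → x ≠ w ∧ ¬ G.Adj w x) ∧
    ∀ i j, i ≠ j → ∃ x y, f x = some i ∧ f y = some j ∧ G.Adj x y

theorem HasAvoidedTriangle.of_iso {V : Type u} {G : SimpleGraph V} (e : K3UnionK1 ≃g G) :
    G.HasAvoidedTriangle := by
  refine ⟨e (Sum.inr 0), fun x => (e.symm x).elim some fun _ => none, ?_, ?_⟩
  · intro x hx
    obtain ⟨y, rfl⟩ := e.surjective x
    rcases y with y | y
    · refine ⟨by simp, ?_⟩
      rw [e.map_adj_iff]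
      simp [K3UnionK1]
    · simp at hx
  · intro i j hij
    refine ⟨e (Sum.inl i), e (Sum.inl j), by simp, by simp, ?_⟩
    rw [e.map_adj_iff]
    simpa [K3UnionK1] using hij

theorem HasAvoidedTriangle.of_induce {V : Type u} {G : SimpleGraph V} {s : Set V}
    (h : (G.induce s).HasAvoidedTriangle) : G.HasAvoidedTriangle := by
  classical
  obtain ⟨w, f, hf, he⟩ := h
  refine ⟨w, fun x => if hx : x ∈ s then f ⟨x, hx⟩ else none, ?_, ?_⟩
  · intro x hx
    by_cases hs : x ∈ s
    · obtain ⟨h1, h2⟩ := hf ⟨x, hs⟩ (by simpa [hs] using hx)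
      exact ⟨fun h => h1 (Subtype.ext h), h2⟩
    · simp [hs] at hx
  · intro i j hij
    obtain ⟨x, y, hx, hy, hxy⟩ := he i j hij
    exact ⟨x, y, by simpa using hx, by simpa using hy, hxy⟩

theorem HasAvoidedTriangle.of_contractEdge {V : Type u} {G : SimpleGraph V} {u v : V}
    (huv : G.Adj u v) (h : (G.contractEdge u v).HasAvoidedTriangle) : G.HasAvoidedTriangle := by
  classical
  obtain ⟨⟨w, hw⟩, f, hf, he⟩ := h
  -- The vertex `v` joins the set of the merged vertex.
  let g : V → Option (Fin 3) := fun x => if hx : x = v then f ⟨u, huv.ne⟩ else f ⟨x, hx⟩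
  have hg (x : {x : V // x ≠ v}) : g x = f x := by simp [g, x.2]
  have hgv : g v = f ⟨u, huv.ne⟩ := by simp [g]
  refine ⟨w, g, ?_, ?_⟩
  · intro x hx
    by_cases hxv : x = v
    · subst hxv
      rw [hgv] at hx
      obtain ⟨h1, h2⟩ := hf _ hx
      exact ⟨hw.symm, fun h => h2 ⟨h1.symm, Or.inr (Or.inr ⟨rfl, h.symm⟩)⟩⟩
    · rw [hg ⟨x, hxv⟩] at hx
      obtain ⟨h1, h2⟩ := hf _ hx
      exact ⟨fun h => h1 (Subtype.ext h), fun h => h2 ⟨h1.symm, Or.inl h⟩⟩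
  · intro i j hij
    obtain ⟨x, y, hx, hy, -, h | ⟨h, h'⟩ | ⟨h, h'⟩⟩ := he i j hij
    · exact ⟨x, y, by rw [hg, hx], by rw [hg, hy], h⟩
    · refine ⟨v, y, ?_, by rw [hg, hy], h'⟩
      rw [hgv, ← hx]
      exact congrArg f (Subtype.ext h.symm)
    · refine ⟨x, v, by rw [hg, hx], ?_, h'.symm⟩
      rw [hgv, ← hy]
      exact congrArg f (Subtype.ext h.symm)

theorem IsInducedMinor.hasAvoidedTriangle {V : Type u} {G : SimpleGraph V}
    (h : IsInducedMinor K3UnionK1 G) : G.HasAvoidedTriangle := by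
  induction h with
  | ofIso e => exact .of_iso e
  | deleteVertex v _ ih => exact ih.of_induce
  | contractEdge u v huv _ ih => exact ih.of_contractEdge huv

/-- The complement of the graph on `Fin n × Fin n` in which every row `{i} × Fin n` is a clique and
`(i, j)` is joined to `(j, i)`. -/
def coDartGraph (n : ℕ) : SimpleGraph (Fin n × Fin n) where
  Adj x y := x.1 ≠ y.1 ∧ y ≠ x.swap
  symm.symm := fun _ _ h => ⟨h.1.symm, fun h' => h.2 (by rw [h', Prod.swap_swap])⟩
  loopless.irrefl := fun _ h => h.1 rfl

theorem coDartGraph_adj {n : ℕ} {x y : Fin n × Fin n} :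
    (coDartGraph n).Adj x y ↔ x.1 ≠ y.1 ∧ y ≠ x.swap := Iff.rfl

theorem not_hasAvoidedTriangle_coDartGraph (n : ℕ) : ¬ (coDartGraph n).HasAvoidedTriangle := by
  rintro ⟨w, f, hf, he⟩
  -- Two of the three sets do not contain `w.swap`, the centre of the star of non-neighbours.
  obtain ⟨i, j, hij, hi, hj⟩ : ∃ i j : Fin 3, i ≠ j ∧ f w.swap ≠ some i ∧ f w.swap ≠ some j := by
    generalize f w.swap = c
    revert c
    decide
  obtain ⟨x, y, hx, hy, hxy⟩ := he i j hij
  have key (z) (k : Fin 3) (hz : f z = some k) (hk : f w.swap ≠ some k) : w.1 = z.1 := by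
    have h := (hf z (by simp [hz])).2
    rw [coDartGraph_adj] at h
    by_contra hne
    exact h ⟨hne, fun h' => hk (h' ▸ hz)⟩
  exact hxy.1 ((key x i hx hi).symm.trans (key y j hy hj))

theorem inducedMinorFree_coDartGraph (n : ℕ) : InducedMinorFree K3UnionK1 (coDartGraph n) :=
  fun h => not_hasAvoidedTriangle_coDartGraph n h.hasAvoidedTriangle

/-! ### Balanced cuts from clique-width expressions -/

namespace CliqueExpr

instance finite_vert {k : ℕ} : (e : CliqueExpr k) → Finite e.Vert
  | vertex _ => inferInstanceAs (Finite Unit)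
  | union a b =>
    haveI := finite_vert a
    haveI := finite_vert b
    inferInstanceAs (Finite (a.Vert ⊕ b.Vert))
  | join _ _ _ a => finite_vert a
  | relabel _ _ a => finite_vert a

/-- `S` is the vertex set of a subexpression in effect: `l` assigns labels to its vertices such that
vertices of `S` with the same label under `l` have the same label in `e` and the same neighbours
outside `S`. -/
def IsCut {k : ℕ} (e : CliqueExpr k) (S : Set e.Vert) (l : e.Vert → Fin k) : Prop :=
  ∀ x ∈ S, ∀ y ∈ S, l x = l y →
    e.label x = e.label y ∧ ∀ z ∉ S, (e.graph.Adj x z ↔ e.graph.Adj y z)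

theorem isCut_univ {k : ℕ} (e : CliqueExpr k) : e.IsCut Set.univ e.label :=
  fun _ _ _ _ h => ⟨h, fun z hz => absurd (Set.mem_univ z) hz⟩

theorem IsCut.join {k : ℕ} {i j : Fin k} (hij : i ≠ j) {a : CliqueExpr k} {S : Set a.Vert}
    {l : a.Vert → Fin k} (h : a.IsCut S l) : (CliqueExpr.join i j hij a).IsCut S l := by
  intro (x : a.Vert) hx (y : a.Vert) hy hxy
  obtain ⟨h1, h2⟩ := h x hx y hy hxy
  refine ⟨h1, fun (z : a.Vert) hz => ?_⟩
  change (a.graph ⊔ fromRel fun x y => a.label x = i ∧ a.label y = j).Adj x z ↔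
    (a.graph ⊔ fromRel fun x y => a.label x = i ∧ a.label y = j).Adj y z
  have hxz : x ≠ z := fun h => hz (h ▸ hx)
  have hyz : y ≠ z := fun h => hz (h ▸ hy)
  simp only [sup_adj, fromRel_adj, h2 z hz, h1, hxz, hyz, ne_eq, not_false_eq_true, true_and]

theorem IsCut.relabel {k : ℕ} (i j : Fin k) {a : CliqueExpr k} {S : Set a.Vert}
    {l : a.Vert → Fin k} (h : a.IsCut S l) : (CliqueExpr.relabel i j a).IsCut S l := by
  intro (x : a.Vert) hx (y : a.Vert) hy hxy
  obtain ⟨h1, h2⟩ := h x hx y hy hxy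
  refine ⟨?_, h2⟩
  change (if a.label x = i then j else a.label x) = if a.label y = i then j else a.label y
  rw [h1]

theorem IsCut.union_left {k : ℕ} {a : CliqueExpr k} (b : CliqueExpr k) {S : Set a.Vert}
    {l : a.Vert → Fin k} (h : a.IsCut S l) :
    (CliqueExpr.union a b).IsCut (Sum.inl '' S) (Sum.elim l b.label) := by
  rintro _ ⟨x, hx, rfl⟩ _ ⟨y, hy, rfl⟩ hxy
  obtain ⟨h1, h2⟩ := h x hx y hy hxy
  refine ⟨h1, fun (z : a.Vert ⊕ b.Vert) hz => ?_⟩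
  change (a.graph ⊕g b.graph).Adj (Sum.inl x) z ↔ (a.graph ⊕g b.graph).Adj (Sum.inl y) z
  rcases z with z | z
  · simpa using h2 z fun h' => hz ⟨z, h', rfl⟩
  · simp

theorem IsCut.union_right {k : ℕ} (a : CliqueExpr k) {b : CliqueExpr k} {S : Set b.Vert}
    {l : b.Vert → Fin k} (h : b.IsCut S l) :
    (CliqueExpr.union a b).IsCut (Sum.inr '' S) (Sum.elim a.label l) := by
  rintro _ ⟨x, hx, rfl⟩ _ ⟨y, hy, rfl⟩ hxy
  obtain ⟨h1, h2⟩ := h x hx y hy hxy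
  refine ⟨h1, fun (z : a.Vert ⊕ b.Vert) hz => ?_⟩
  change (a.graph ⊕g b.graph).Adj (Sum.inr x) z ↔ (a.graph ⊕g b.graph).Adj (Sum.inr y) z
  rcases z with z | z
  · simp
  · simpa using h2 z fun h' => hz ⟨z, h', rfl⟩

/-- Descend from the root, keeping more than `m` vertices. A disjoint union with more than `2m`
vertices has an operand with more than `m`, so the descent can go on until at most `2m` vertices are
left. -/
theorem exists_balanced_cut {k m : ℕ} (hm : 1 ≤ m) (e : CliqueExpr k) (he : m < Nat.card e.Vert) :
    ∃ (S : Set e.Vert) (l : e.Vert → Fin k), m < S.ncard ∧ S.ncard ≤ 2 * m ∧ e.IsCut S l := by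
  induction e with
  | vertex i =>
    have : Nat.card (vertex i).Vert = 1 := Nat.card_unique (α := Unit)
    omega
  | union a b iha ihb =>
    have hcard : Nat.card (union a b).Vert = Nat.card a.Vert + Nat.card b.Vert :=
      Nat.card_sum (α := a.Vert) (β := b.Vert)
    by_cases hle : Nat.card (union a b).Vert ≤ 2 * m
    · exact ⟨Set.univ, _, by rwa [Set.ncard_univ], by rwa [Set.ncard_univ], isCut_univ _⟩
    by_cases ha : m < Nat.card a.Vert
    · obtain ⟨S, l, h1, h2, h3⟩ := iha ha
      have hS : (Sum.inl '' S : Set (a.Vert ⊕ b.Vert)).ncard = S.ncard :=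
        Set.ncard_image_of_injective S Sum.inl_injective
      exact ⟨_, _, h1.trans_eq hS.symm, hS.trans_le h2, h3.union_left b⟩
    · obtain ⟨S, l, h1, h2, h3⟩ := ihb (by omega)
      have hS : (Sum.inr '' S : Set (a.Vert ⊕ b.Vert)).ncard = S.ncard :=
        Set.ncard_image_of_injective S Sum.inr_injective
      exact ⟨_, _, h1.trans_eq hS.symm, hS.trans_le h2, h3.union_right a⟩
  | join i j hij a ih =>
    obtain ⟨S, l, h1, h2, h3⟩ := ih he
    exact ⟨S, l, h1, h2, h3.join hij⟩
  | relabel i j a ih =>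
    obtain ⟨S, l, h1, h2, h3⟩ := ih he
    exact ⟨S, l, h1, h2, h3.relabel i j⟩

end CliqueExpr

theorem exists_balanced_cut_of_iso {V : Type*} [Fintype V] {G : SimpleGraph V}
    {k m : ℕ} (hm : 1 ≤ m) (hV : m < Fintype.card V) {e : CliqueExpr k} (φ : e.graph ≃g G) :
    ∃ (S : Finset V) (l : V → Fin k), m < S.card ∧ S.card ≤ 2 * m ∧
      ∀ x ∈ S, ∀ y ∈ S, l x = l y → ∀ z ∉ S, (G.Adj x z ↔ G.Adj y z) := by
  classical
  obtain ⟨S, l, h1, h2, h3⟩ := e.exists_balanced_cut hm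
    (by rwa [Nat.card_congr φ.toEquiv, Nat.card_eq_fintype_card])
  have hS : (φ '' S).toFinset.card = S.ncard := by
    rw [← Set.ncard_eq_toFinset_card', Set.ncard_image_of_injective S φ.injective]
  refine ⟨(φ '' S).toFinset, fun x => l (φ.symm x), hS ▸ h1, hS ▸ h2, ?_⟩
  intro x hx y hy hxy z hz
  obtain ⟨x, hx', rfl⟩ := Set.mem_toFinset.mp hx
  obtain ⟨y, hy', rfl⟩ := Set.mem_toFinset.mp hy
  obtain ⟨z, rfl⟩ := φ.surjective z
  rw [φ.map_adj_iff, φ.map_adj_iff]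
  exact (h3 x hx' y hy' (by simpa using hxy)).2 z fun h => hz (Set.mem_toFinset.mpr ⟨z, h, rfl⟩)

/-! ### Cuts of the graphs `coDartGraph n` -/

section Cuts

variable {n k : ℕ} {S : Finset (Fin n × Fin n)} {l : Fin n × Fin n → Fin k}

/-- At most two rows share a class: if vertices of `S` in rows `i` and `i'` have the same class, then
a vertex outside `S` in row `i`, being non-adjacent to the former, is non-adjacent to the latter,
which therefore is `(i', i)`; and `i` can be recovered from `(i', i)`. -/
theorem card_mixed_rows_le
    (hl : ∀ x ∈ S, ∀ y ∈ S, l x = l y → ∀ z ∉ S,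
      ((coDartGraph n).Adj x z ↔ (coDartGraph n).Adj y z))
    (M : Finset (Fin n)) (hM : ∀ i ∈ M, (∃ j, (i, j) ∈ S) ∧ ∃ j, (i, j) ∉ S) :
    M.card ≤ 2 * k := by
  choose! a ha using fun i hi => (hM i hi).1
  choose! b hb using fun i hi => (hM i hi).2
  have key (i) (hi : i ∈ M) (i') (hi' : i' ∈ M) (hne : i ≠ i') (h : l (i, a i) = l (i', a i')) :
      a i' = i := by
    have := hl _ (ha i hi) _ (ha i' hi') h _ (hb i hi)
    simp only [coDartGraph_adj, Prod.swap_prod_mk, ne_eq, Prod.mk.injEq] at this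
    grind
  have := Finset.card_le_mul_card_image_of_maps_to (s := M) (t := Finset.univ)
    (f := fun i => l (i, a i)) (fun _ _ => Finset.mem_univ _) 2 ?_
  · simpa using this
  intro c _
  by_contra! hlt
  obtain ⟨p, q, r, hp, hq, hr, hpq, hpr, hqr⟩ := Finset.two_lt_card_iff.mp hlt
  simp only [Finset.mem_filter] at hp hq hr
  have h1 := key p hp.1 q hq.1 hpq (hp.2.trans hq.2.symm)
  have h2 := key r hr.1 q hq.1 hqr.symm (hr.2.trans hq.2.symm)
  exact hpr (h1.symm.trans h2)

theorem card_empty_rows_le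
    (hl : ∀ x ∈ S, ∀ y ∈ S, l x = l y → ∀ z ∉ S,
      ((coDartGraph n).Adj x z ↔ (coDartGraph n).Adj y z))
    {i : Fin n} (hi : ∀ j, (i, j) ∈ S) (E : Finset (Fin n)) (hE : ∀ j ∈ E, ∀ j', (j, j') ∉ S) :
    E.card ≤ k := by
  have := Finset.card_le_card_of_injOn (s := E) (t := Finset.univ) (fun j => l (i, j))
    (fun _ _ => Finset.mem_coe.mpr (Finset.mem_univ _)) ?_
  · simpa using this
  intro j hj j' hj' h
  have hij : i ≠ j := by
    rintro rfl
    exact hE i hj i (hi i)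
  have := hl _ (hi j) _ (hi j') h _ (hE j hj i)
  simp only [coDartGraph_adj, Prod.swap_prod_mk, ne_eq, Prod.mk.injEq] at this
  grind

end Cuts

theorem card_mul_le_of_rows_subset {n : ℕ} (F : Finset (Fin n)) (T : Finset (Fin n × Fin n))
    (h : ∀ i ∈ F, ∀ j, (i, j) ∈ T) : F.card * n ≤ T.card := by
  have := Finset.card_le_card (s := F ×ˢ (Finset.univ : Finset (Fin n))) (t := T) (by
    intro x hx
    exact h x.1 (Finset.mem_product.mp hx).1 x.2)
  simpa using this

theorem lt_cliqueWidth_coDartGraph {c t : ℕ} (ht : 3 * c < t) :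
    c < cliqueWidth (coDartGraph (3 * t)) := by
  classical
  by_contra! hk
  have : Nonempty (Fin (3 * t) × Fin (3 * t)) := ⟨⟨0, by omega⟩, ⟨0, by omega⟩⟩
  obtain ⟨e, ⟨φ⟩⟩ := exists_cliqueExpr_cliqueWidth (coDartGraph (3 * t))
  generalize cliqueWidth (coDartGraph (3 * t)) = k at hk e
  obtain ⟨S, l, h1, h2, hl⟩ := exists_balanced_cut_of_iso (m := 3 * (t * t))
    (by nlinarith) (by simp only [Fintype.card_prod, Fintype.card_fin]; nlinarith) φ
  let F : Finset (Fin (3 * t)) := {i | ∀ j, (i, j) ∈ S}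
  let E : Finset (Fin (3 * t)) := {i | ∀ j, (i, j) ∉ S}
  let M : Finset (Fin (3 * t)) := {i | (∃ j, (i, j) ∈ S) ∧ ∃ j, (i, j) ∉ S}
  have hF : F.card ≤ 2 * t := by
    have := card_mul_le_of_rows_subset F S fun i hi => (Finset.mem_filter.mp hi).2
    by_contra! h
    nlinarith
  have hE : E.card ≤ 2 * t := by
    have := card_mul_le_of_rows_subset E Sᶜ fun i hi j =>
      Finset.mem_compl.mpr ((Finset.mem_filter.mp hi).2 j)
    have hS := Finset.card_add_card_compl S
    simp only [Fintype.card_prod, Fintype.card_fin] at hS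
    by_contra! h
    nlinarith
  have hM : M.card ≤ 2 * k := card_mixed_rows_le hl M fun i hi => (Finset.mem_filter.mp hi).2
  have hcover : 3 * t ≤ F.card + E.card + M.card := by
    have hsub : (Finset.univ : Finset (Fin (3 * t))) ⊆ F ∪ E ∪ M := by
      intro i _
      simp only [F, E, M, Finset.mem_union, Finset.mem_filter, Finset.mem_univ, true_and]
      grind
    calc 3 * t = (Finset.univ : Finset (Fin (3 * t))).card := by simp
      _ ≤ (F ∪ E ∪ M).card := Finset.card_le_card hsub
      _ ≤ (F ∪ E).card + M.card := Finset.card_union_le _ _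
      _ ≤ F.card + E.card + M.card := by
        have := Finset.card_union_le F E
        omega
  obtain ⟨i, hi⟩ : F.Nonempty := Finset.card_pos.mp (by omega)
  have := card_empty_rows_le hl (Finset.mem_filter.mp hi).2 E
    fun j hj => (Finset.mem_filter.mp hj).2
  omega

end SimpleGraph

theorem mainTheorem6 :
    ¬ ∃ c : ℕ, ∀ (V : Type) [Finite V] (G : SimpleGraph V),
      SimpleGraph.InducedMinorFree SimpleGraph.K3UnionK1 G → SimpleGraph.cliqueWidth G ≤ c := by
  rintro ⟨c, hc⟩
  exact (SimpleGraph.lt_cliqueWidth_coDartGraph (Nat.lt_succ_self (3 * c))).not_ge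
    (hc _ _ (SimpleGraph.inducedMinorFree_coDartGraph _))
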